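/- Let $n$ be a natural number. A *substitution algebra with transpositions of dimension $n$* is a Boolean algebra $A$ with unary operations $s^i_j$ and $s_{ij}$ for all distinct $i,j<n$ (corresponding to the replacement $[i|j]$, which sends $i$ to $j$ and fixes everything else, and to the transposition $[i,j]$), all of which are Boolean endomorphisms, such that the following equations hold for all $x\in A$ and all indices below $n$, where the distinct letters of each equation denote distinct indices: $$s_{ij}x=s_{ji}x,\quad s_{ij}s_{ij}x=x,\quad s_{ij}s_{jk}s_{ij}x=s_{ik}x,\quad s_{ij}s_{kl}x=s_{kl}s_{ij}x,$$ $$s_{kl}s^j_is_{kl}x=s^j_ix,\quad s_{jk}s^j_is_{jk}x=s^k_ix,\quad s_{ki}s^j_is_{ki}x=s^j_kx,\quad s_{ij}s^j_is_{ij}x=s^i_jx,$$ $$s^j_is^k_lx=s^k_ls^j_ix,\quad s^j_is^k_ix=s^k_is^j_ix=s^j_is^k_jx,\quad s^j_is^i_kx=s^j_ks_{ij}x,$$ $$s^j_is^j_kx=s^j_kx,\quad s^j_is^j_ix=s^j_ix,\quad s^j_is^i_jx=s^j_ix,\quad s^j_is_{ij}x=s^j_ix.$$ Let $SA_n$ be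 the variety of these algebras. Then: 1. $SA_n$ is locally finite: in every $A\in SA_n$, every finitely generated subalgebra is finite. More precisely, if $A\in SA_n$ is generated by a set of $m$ elements, $m$ finite, then $A$ is finite and $|A|\le 2^{2^{m\cdot n^n}}$. 2. $SA_n$ has the superamalgamation property: for all $A,B,C\in SA_n$ and all monomorphisms $p:A\to B$, $q:A\to C$ there are $D\in SA_n$ and monomorphisms $f:B\to D$, $g:C\to D$ with $f\circ p=g\circ q$ such that for all $b\in B$ and $c\in C$: if $f(b)\le g(c)$, then there is $a\in A$ with $b\le p(a)$ and $q(a)\le c$; and if $g(c)\le f(b)$, then there is $a\in A$ with $c\le q(a)$ and $p(a)\le b$. -/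

import Mathlib

universe u v

/-- Substitution algebras with transpositions of dimension `n`: Boolean algebras with unary operations
`rp i j` (written `s^i_j`, for the replacement `[i|j]`, which sends `i` to `j` and fixes everything
else) and `tr i j` (written `s_{ij}`, for the transposition `[i,j]`), for distinct `i, j < n`. The
equations say that all the operations are Boolean endomorphisms, and encode a presentation of the
monoid of all maps `n → n` by replacements and transpositions (with `s_σ s_τ = s_{σ ∘ τ}`). -/
class SA (n : ℕ) (A : Type u) [BooleanAlgebra A] where
  /-- `tr i j` is the operation `s_{ij}`. -/
  tr (i j : Fin n) (h : i ≠ j) : A → A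
  /-- `rp i j` is the operation `s^i_j`. -/
  rp (i j : Fin n) (h : i ≠ j) : A → A
  -- The operations are Boolean endomorphisms.
  tr_inf (i j : Fin n) (h : i ≠ j) (x y : A) : tr i j h (x ⊓ y) = tr i j h x ⊓ tr i j h y
  tr_compl (i j : Fin n) (h : i ≠ j) (x : A) : tr i j h xᶜ = (tr i j h x)ᶜ
  rp_inf (i j : Fin n) (h : i ≠ j) (x y : A) : rp i j h (x ⊓ y) = rp i j h x ⊓ rp i j h y
  rp_compl (i j : Fin n) (h : i ≠ j) (x : A) : rp i j h xᶜ = (rp i j h x)ᶜ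
  -- The relations between transpositions (symmetric group).
  /-- `s_{ij} x = s_{ji} x` -/
  tr_symm (i j : Fin n) (h : i ≠ j) (x : A) : tr i j h x = tr j i h.symm x
  /-- `s_{ij} s_{ij} x = x` -/
  tr_tr (i j : Fin n) (h : i ≠ j) (x : A) : tr i j h (tr i j h x) = x
  /-- `s_{ij} s_{jk} s_{ij} x = s_{ik} x` -/
  tr_conj (i j k : Fin n) (hij : i ≠ j) (hjk : j ≠ k) (hik : i ≠ k) (x : A) :
    tr i j hij (tr j k hjk (tr i j hij x)) = tr i k hik x
  /-- `s_{ij} s_{kl} x = s_{kl} s_{ij} x` -/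
  tr_comm (i j k l : Fin n) (hij : i ≠ j) (_hik : i ≠ k) (_hil : i ≠ l) (_hjk : j ≠ k)
    (_hjl : j ≠ l) (hkl : k ≠ l) (x : A) :
    tr i j hij (tr k l hkl x) = tr k l hkl (tr i j hij x)
  -- Conjugation of replacements by transpositions.
  /-- `s_{kl} s^j_i s_{kl} x = s^j_i x` -/
  conj_disjoint (i j k l : Fin n) (hij : i ≠ j) (_hik : i ≠ k) (_hil : i ≠ l) (_hjk : j ≠ k)
    (_hjl : j ≠ l) (hkl : k ≠ l) (x : A) :
    tr k l hkl (rp j i hij.symm (tr k l hkl x)) = rp j i hij.symm x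
  /-- `s_{jk} s^j_i s_{jk} x = s^k_i x` -/
  conj_source (i j k : Fin n) (hij : i ≠ j) (hjk : j ≠ k) (hik : i ≠ k) (x : A) :
    tr j k hjk (rp j i hij.symm (tr j k hjk x)) = rp k i hik.symm x
  /-- `s_{ki} s^j_i s_{ki} x = s^j_k x` -/
  conj_target (i j k : Fin n) (hij : i ≠ j) (hjk : j ≠ k) (hik : i ≠ k) (x : A) :
    tr k i hik.symm (rp j i hij.symm (tr k i hik.symm x)) = rp j k hjk x
  /-- `s_{ij} s^j_i s_{ij} x = s^i_j x` -/
  conj_swap (i j : Fin n) (hij : i ≠ j) (x : A) :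
    tr i j hij (rp j i hij.symm (tr i j hij x)) = rp i j hij x
  -- Products of replacements.
  /-- `s^j_i s^k_l x = s^k_l s^j_i x` -/
  rp_comm (i j k l : Fin n) (hij : i ≠ j) (_hik : i ≠ k) (_hil : i ≠ l) (_hjk : j ≠ k)
    (_hjl : j ≠ l) (hkl : k ≠ l) (x : A) :
    rp j i hij.symm (rp k l hkl x) = rp k l hkl (rp j i hij.symm x)
  /-- `s^j_i s^k_i x = s^k_i s^j_i x` -/
  rp_comm_target (i j k : Fin n) (hij : i ≠ j) (_hjk : j ≠ k) (hik : i ≠ k) (x : A) :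
    rp j i hij.symm (rp k i hik.symm x) = rp k i hik.symm (rp j i hij.symm x)
  /-- `s^k_i s^j_i x = s^j_i s^k_j x` -/
  rp_chain (i j k : Fin n) (hij : i ≠ j) (hjk : j ≠ k) (hik : i ≠ k) (x : A) :
    rp k i hik.symm (rp j i hij.symm x) = rp j i hij.symm (rp k j hjk.symm x)
  /-- `s^j_i s^i_k x = s^j_k s_{ij} x` -/
  rp_rp_eq_rp_tr (i j k : Fin n) (hij : i ≠ j) (hjk : j ≠ k) (hik : i ≠ k) (x : A) :
    rp j i hij.symm (rp i k hik x) = rp j k hjk (tr i j hij x)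
  /-- `s^j_i s^j_k x = s^j_k x` -/
  rp_absorb (i j k : Fin n) (hij : i ≠ j) (hjk : j ≠ k) (_hik : i ≠ k) (x : A) :
    rp j i hij.symm (rp j k hjk x) = rp j k hjk x
  /-- `s^j_i s^j_i x = s^j_i x` -/
  rp_idem (i j : Fin n) (hij : i ≠ j) (x : A) :
    rp j i hij.symm (rp j i hij.symm x) = rp j i hij.symm x
  /-- `s^j_i s^i_j x = s^j_i x` -/
  rp_rp_swap (i j : Fin n) (hij : i ≠ j) (x : A) :
    rp j i hij.symm (rp i j hij x) = rp j i hij.symm x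
  /-- `s^j_i s_{ij} x = s^j_i x` -/
  rp_tr (i j : Fin n) (hij : i ≠ j) (x : A) :
    rp j i hij.symm (tr i j hij x) = rp j i hij.symm x

namespace SA

/-- `S` is (the universe of) a subalgebra. The constant `⊥` is the value of the term `x ⊓ xᶜ`. -/
structure IsSubalgebra (n : ℕ) {A : Type u} [BooleanAlgebra A] [SA n A] (S : Set A) : Prop where
  bot_mem : ⊥ ∈ S
  inf_mem : ∀ x ∈ S, ∀ y ∈ S, x ⊓ y ∈ S
  compl_mem : ∀ x ∈ S, xᶜ ∈ S
  tr_mem : ∀ (i j : Fin n) (h : i ≠ j), ∀ x ∈ S, tr i j h x ∈ S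
  rp_mem : ∀ (i j : Fin n) (h : i ≠ j), ∀ x ∈ S, rp i j h x ∈ S

/-- The subalgebra generated by `X`. -/
def Sg (n : ℕ) {A : Type u} [BooleanAlgebra A] [SA n A] (X : Set A) : Set A :=
  ⋂₀ {S : Set A | IsSubalgebra n S ∧ X ⊆ S}

/-- `f` is a monomorphism (injective homomorphism) of substitution algebras. -/
structure IsMono (n : ℕ) {A : Type u} {B : Type v} [BooleanAlgebra A] [SA n A]
    [BooleanAlgebra B] [SA n B] (f : A → B) : Prop where
  injective : Function.Injective f
  map_inf : ∀ x y : A, f (x ⊓ y) = f x ⊓ f y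
  map_compl : ∀ x : A, f xᶜ = (f x)ᶜ
  map_tr : ∀ (i j : Fin n) (h : i ≠ j) (x : A), f (tr i j h x) = tr i j h (f x)
  map_rp : ∀ (i j : Fin n) (h : i ≠ j) (x : A), f (rp i j h x) = rp i j h (f x)

/-- Local finiteness: finitely generated subalgebras are finite. -/
def LocallyFinite (n : ℕ) : Prop :=
  ∀ (A : Type u) [BooleanAlgebra A] [SA n A] (X : Set A), X.Finite → (Sg n X).Finite

/-- The superamalgamation property of the class of `n`-dimensional substitution algebras. -/
def SuperAmalgamation (n : ℕ) : Prop :=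
  ∀ (A B C : Type u) [BooleanAlgebra A] [BooleanAlgebra B] [BooleanAlgebra C]
    [SA n A] [SA n B] [SA n C] (p : A → B) (q : A → C), IsMono n p → IsMono n q →
    ∃ (D : Type u) (_ : BooleanAlgebra D) (_ : SA n D) (f : B → D) (g : C → D),
      IsMono n f ∧ IsMono n g ∧ (∀ a : A, f (p a) = g (q a)) ∧
      (∀ (b : B) (c : C), f b ≤ g c → ∃ a : A, b ≤ p a ∧ q a ≤ c) ∧
      (∀ (b : B) (c : C), g c ≤ f b → ∃ a : A, c ≤ q a ∧ p a ≤ b)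

end SA

/-! The equations present the monoid of self-maps of `Fin n`: two compositions of the operations
that denote the same self-map are equal (`pairs_functional`). Hence an algebra has at most `n ^ n`
composite operations. Composites are Boolean endomorphisms, so a point (ultrafilter) of the algebra,
restricted to the subalgebra generated by `X`, is determined by its truth values at the elements `w
x` with `x ∈ X` and `w` a composite. An element of that subalgebra is determined by the set of such
value patterns of the points containing it (`traces_injective`), which gives both finiteness and the
double exponential bound.

The presentation is proved by induction on the index set: a word over `insert a s` has the form `t a
j * r a i * w` with `w` a word over `s`, and, up to a transposition, the self-map determines what is
left.

For amalgamation, all operations are Boolean endomorphisms and so dualize to functions on points.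
The pairs of points of `B` and `C` with the same restriction to `A` are closed under these
functions, and the power set of this pullback is the amalgam `D`. Its equations are inherited from
`B` and `C`. If no interpolant in `A` exists, the prime ideal theorem yields a pair in the pullback
that refutes the inequality (`exists_mem_not_mem`). Injectivity of the embeddings is the case of
interpolation at `⊥`. -/

namespace SA

/-! ### Presentation of the monoid of self-maps by transpositions and replacements. -/

/-- The defining relations between transpositions `t a b` and replacements `r a b` (`a` goes to `b`)
in a monoid, uniformly in all indices: both are `1` when the indices coincide. -/
structure TransformationRelations {α M : Type*} [DecidableEq α] [Monoid M] (t r : α → α → M) :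
    Prop where
  t_self : ∀ a, t a a = 1
  r_self : ∀ a, r a a = 1
  t_symm : ∀ a b, t a b = t b a
  t_mul_t_self : ∀ a b, t a b * t a b = 1
  t_mul_t : ∀ a b c d, t a b * t c d = t (Equiv.swap a b c) (Equiv.swap a b d) * t a b
  t_mul_r : ∀ a b c d, t a b * r c d = r (Equiv.swap a b c) (Equiv.swap a b d) * t a b
  t_mul_r_self : ∀ a b, t a b * r a b = r b a
  r_comm : ∀ a i b c, b ≠ a → b ≠ i → c ≠ a → r a i * r b c = r b c * r a i
  r_chain : ∀ a b c, a ≠ b → a ≠ c → r b c * r a b = r a c * r b c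
  r_absorb : ∀ a c i, i ≠ a → r a c * r a i = r a i
  r_mul_r : ∀ a b c, c ≠ b → r a b * r b c = t a b * r b c

namespace TransformationRelations

variable {α M M' : Type*} [Monoid M] [Monoid M']

/-- Used to pair an abstract word with the self-map it denotes, so that one normal form computation
serves both coordinates at once. -/
theorem prod [DecidableEq α] {t r : α → α → M} {t' r' : α → α → M'}
    (h : TransformationRelations t r)
    (h' : TransformationRelations t' r') :
    TransformationRelations (fun a b => (t a b, t' a b)) (fun a b => (r a b, r' a b)) where
  t_self a := Prod.ext (h.t_self a) (h'.t_self a)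
  r_self a := Prod.ext (h.r_self a) (h'.r_self a)
  t_symm a b := Prod.ext (h.t_symm a b) (h'.t_symm a b)
  t_mul_t_self a b := Prod.ext (h.t_mul_t_self a b) (h'.t_mul_t_self a b)
  t_mul_t a b c d := Prod.ext (h.t_mul_t a b c d) (h'.t_mul_t a b c d)
  t_mul_r a b c d := Prod.ext (h.t_mul_r a b c d) (h'.t_mul_r a b c d)
  t_mul_r_self a b := Prod.ext (h.t_mul_r_self a b) (h'.t_mul_r_self a b)
  r_comm a i b c h₁ h₂ h₃ := Prod.ext (h.r_comm a i b c h₁ h₂ h₃) (h'.r_comm a i b c h₁ h₂ h₃)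
  r_chain a b c h₁ h₂ := Prod.ext (h.r_chain a b c h₁ h₂) (h'.r_chain a b c h₁ h₂)
  r_absorb a c i h₁ := Prod.ext (h.r_absorb a c i h₁) (h'.r_absorb a c i h₁)
  r_mul_r a b c h₁ := Prod.ext (h.r_mul_r a b c h₁) (h'.r_mul_r a b c h₁)

/-- The submonoid generated by the transpositions and replacements with indices in `s`. -/
def words (t r : α → α → M) (s : Finset α) : Submonoid M :=
  Submonoid.closure {x | ∃ a ∈ s, ∃ b ∈ s, x = t a b ∨ x = r a b}

theorem t_mem_words (t r : α → α → M) {s : Finset α} {a b : α} (ha : a ∈ s) (hb : b ∈ s) :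
    t a b ∈ words t r s :=
  Submonoid.subset_closure ⟨a, ha, b, hb, Or.inl rfl⟩

theorem r_mem_words (t r : α → α → M) {s : Finset α} {a b : α} (ha : a ∈ s) (hb : b ∈ s) :
    r a b ∈ words t r s :=
  Submonoid.subset_closure ⟨a, ha, b, hb, Or.inr rfl⟩

theorem mul_eq_comp (f g : Function.End α) (x : α) : (f * g) x = f (g x) := rfl

/-- The normal form of a word over `insert a s` in terms of words over `s`. -/
def IsNormal [DecidableEq α] (t r : α → α → M) (a : α) (s : Finset α) (x : M) : Prop :=
  ∃ j ∈ insert a s, ∃ i ∈ insert a s, ∃ w ∈ words t r s, x = t a j * (r a i * w)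

variable [DecidableEq α] {t r : α → α → M}

theorem swap_mem {s : Finset α} {a b c : α} (ha : a ∈ s) (hb : b ∈ s) (hc : c ∈ s) :
    Equiv.swap a b c ∈ s := by
  rw [Equiv.swap_apply_def]; split_ifs <;> assumption

theorem isNormal_t_mul_of_mem (h : TransformationRelations t r) {a b c : α} {s : Finset α}
    (ha : a ∉ s) (hb : b ∈ s) (hc : c ∈ s) {x : M} (hx : IsNormal t r a s x) :
    IsNormal t r a s (t b c * x) := by
  obtain ⟨j, hj, i, hi, w, hw, rfl⟩ := hx
  have hb' := Finset.mem_insert_of_mem (b := a) hb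
  have hc' := Finset.mem_insert_of_mem (b := a) hc
  have hab : a ≠ b := fun e => ha (e ▸ hb)
  have hac : a ≠ c := fun e => ha (e ▸ hc)
  refine ⟨Equiv.swap b c j, swap_mem hb' hc' hj, Equiv.swap b c i, swap_mem hb' hc' hi,
    t b c * w, mul_mem (t_mem_words t r hb hc) hw, ?_⟩
  rw [← mul_assoc, h.t_mul_t, mul_assoc, ← mul_assoc (t b c), h.t_mul_r,
    Equiv.swap_apply_of_ne_of_ne hab hac, mul_assoc]

/-- The `t a j` act as coset representatives: `t a k * t a j = t k j * t a k` when `j`, `k` and `a`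
are distinct, and `t k j` does not involve `a`, so it can be pushed through to the word over `s`. -/
theorem isNormal_t_mul_left (h : TransformationRelations t r) {a k : α} {s : Finset α}
    (ha : a ∉ s) (hk : k ∈ insert a s) {x : M} (hx : IsNormal t r a s x) :
    IsNormal t r a s (t a k * x) := by
  have hx₀ := hx
  obtain ⟨j, hj, i, hi, w, hw, rfl⟩ := hx
  by_cases hka : k = a
  · subst hka; rwa [h.t_self, one_mul]
  by_cases hja : j = a
  · subst hja; exact ⟨k, hk, i, hi, w, hw, by rw [h.t_self, one_mul]⟩
  by_cases hjk : j = k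
  · subst hjk
    exact ⟨a, by simp, i, hi, w, hw, by rw [← mul_assoc, h.t_mul_t_self, h.t_self]⟩
  have hks : k ∈ s := (Finset.mem_insert.1 hk).resolve_left hka
  have hjs : j ∈ s := (Finset.mem_insert.1 hj).resolve_left hja
  have e : t a k * t a j = t k j * t a k := by
    rw [h.t_mul_t, Equiv.swap_apply_left, Equiv.swap_apply_of_ne_of_ne hja hjk]
  rw [← mul_assoc, e, mul_assoc]
  exact isNormal_t_mul_of_mem h ha hks hjs ⟨k, hk, i, hi, w, hw, rfl⟩

theorem isNormal_t_mul (h : TransformationRelations t r) {a b c : α} {s : Finset α}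
    (ha : a ∉ s) (hb : b ∈ insert a s) (hc : c ∈ insert a s) {x : M}
    (hx : IsNormal t r a s x) : IsNormal t r a s (t b c * x) := by
  rcases Finset.mem_insert.1 hb with rfl | hbs
  · exact isNormal_t_mul_left h ha hc hx
  rcases Finset.mem_insert.1 hc with rfl | hcs
  · rw [h.t_symm]
    exact isNormal_t_mul_left h ha hb hx
  exact isNormal_t_mul_of_mem h ha hbs hcs hx

/-- When `b` and `c` lie in `s`, `r b c` moves past `r a i` into `w`, possibly changing `i`. When
`a` is the source it is absorbed or replaces a trivial `r a i`. When `a` is the target it turns into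
a transposition. -/
theorem isNormal_r_mul_r_mul (h : TransformationRelations t r) {a b c i : α} {s : Finset α}
    (ha : a ∉ s) (hb : b ∈ insert a s) (hc : c ∈ insert a s) (hi : i ∈ insert a s) {w : M}
    (hw : w ∈ words t r s) : IsNormal t r a s (r b c * (r a i * w)) := by
  have haa : a ∈ insert a s := Finset.mem_insert_self a s
  have key : ∀ i ∈ insert a s, ∀ w ∈ words t r s, IsNormal t r a s (r a i * w) :=
    fun i hi w hw => ⟨a, haa, i, hi, w, hw, by rw [h.t_self, one_mul]⟩
  by_cases hba : b = a
  · subst hba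
    by_cases hib : i = b
    · subst hib
      rw [h.r_self, one_mul]
      exact key c hc w hw
    · rw [← mul_assoc, h.r_absorb _ _ _ hib]
      exact key i hi w hw
  have hbs : b ∈ s := (Finset.mem_insert.1 hb).resolve_left hba
  by_cases hca : c = a
  · subst hca
    by_cases hic : i = c
    · subst hic
      rw [h.r_self, one_mul, ← h.t_mul_r_self, mul_assoc]
      exact ⟨b, hb, b, hb, w, hw, rfl⟩
    · rw [← mul_assoc, h.r_mul_r _ _ _ hic, mul_assoc]
      exact isNormal_t_mul h ha hb haa (key i hi w hw)
  have hcs : c ∈ s := (Finset.mem_insert.1 hc).resolve_left hca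
  have hw' : r b c * w ∈ words t r s := mul_mem (r_mem_words t r hbs hcs) hw
  by_cases hib : b = i
  · subst hib
    rw [← mul_assoc, h.r_chain _ _ _ (Ne.symm hba) (Ne.symm hca), mul_assoc]
    exact key c hc _ hw'
  · rw [← mul_assoc, ← h.r_comm _ _ _ _ hba hib hca, mul_assoc]
    exact key i hi _ hw'

theorem isNormal_of_mem_words (h : TransformationRelations t r) {a : α} {s : Finset α}
    (ha : a ∉ s) {x : M} (hx : x ∈ words t r (insert a s)) : IsNormal t r a s x := by
  have haa : a ∈ insert a s := Finset.mem_insert_self a s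
  induction hx using Submonoid.closure_induction_left with
  | one => exact ⟨a, haa, a, haa, 1, one_mem _, by simp [h.t_self, h.r_self]⟩
  | mul_left g hg y _ ih =>
    obtain ⟨b, hb, c, hc, rfl | rfl⟩ := hg
    · exact isNormal_t_mul h ha hb hc ih
    · obtain ⟨j, hj, i, hi, w, hw, rfl⟩ := ih
      -- Taken at the swapped indices, so that swapping again restores `b` and `c`: this carries `r
      -- b c` to the right of `t a j`.
      have e := h.t_mul_r a j (Equiv.swap a j b) (Equiv.swap a j c)
      rw [Equiv.swap_apply_self, Equiv.swap_apply_self] at e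
      rw [← mul_assoc, ← e, mul_assoc]
      exact isNormal_t_mul h ha haa hj (isNormal_r_mul_r_mul h ha
        (swap_mem haa hj hb) (swap_mem haa hj hc) hi hw)

/-- The transposition of `a` and `b` as a self-map. -/
def swapMap (a b : α) : Function.End α := fun x => Equiv.swap a b x

/-- The replacement of `a` by `b` as a self-map. -/
def replMap (a b : α) : Function.End α := fun x => if x = a then b else x

theorem transformationRelations_maps :
    TransformationRelations (swapMap (α := α)) replMap where
  t_self a := by funext x; simp [swapMap, Function.End.one_def]
  r_self a := by funext x; simp +contextual [replMap, Function.End.one_def, eq_comm]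
  t_symm a b := by funext x; simp only [swapMap, Equiv.swap_comm a b]
  t_mul_t_self a b := by funext x; simp [swapMap, mul_eq_comp, Function.End.one_def]
  t_mul_t a b c d := by
    funext x; simp only [swapMap, mul_eq_comp, Equiv.swap_apply_def]; grind
  t_mul_r a b c d := by
    funext x; simp only [swapMap, replMap, mul_eq_comp, Equiv.swap_apply_def]; grind
  t_mul_r_self a b := by
    funext x; simp only [swapMap, replMap, mul_eq_comp, Equiv.swap_apply_def]; grind
  r_comm a i b c _ _ _ := by funext x; simp only [replMap, mul_eq_comp]; grind
  r_chain a b c _ _ := by funext x; simp only [replMap, mul_eq_comp]; grind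
  r_absorb a c i _ := by funext x; simp only [replMap, mul_eq_comp]; grind
  r_mul_r a b c _ := by
    funext x; simp only [swapMap, replMap, mul_eq_comp, Equiv.swap_apply_def]; grind

/-- Pairs of a word in the monoid and the self-map that it denotes. -/
def pairs (t r : α → α → M) (s : Finset α) : Submonoid (M × Function.End α) :=
  words (fun a b => (t a b, swapMap a b)) (fun a b => (r a b, replMap a b)) s

theorem map_mem_of_mem_pairs {s : Finset α} {x : M × Function.End α} (hx : x ∈ pairs t r s) :
    ∀ c ∈ s, x.2 c ∈ s := by
  induction hx using Submonoid.closure_induction_left with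
  | one => exact fun c hc => hc
  | mul_left g hg y _ ih =>
    intro c hc
    obtain ⟨a, ha, b, hb, rfl | rfl⟩ := hg
    · exact swap_mem ha hb (ih c hc)
    · change (if y.2 c = a then b else y.2 c) ∈ s
      split_ifs
      exacts [hb, ih c hc]

theorem map_eq_of_mem_pairs {s : Finset α} {x : M × Function.End α} (hx : x ∈ pairs t r s) :
    ∀ c ∉ s, x.2 c = c := by
  induction hx using Submonoid.closure_induction_left with
  | one => exact fun c hc => rfl
  | mul_left g hg y _ ih =>
    intro c hc
    obtain ⟨a, ha, b, hb, rfl | rfl⟩ := hg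
    · change Equiv.swap a b (y.2 c) = c
      rw [ih c hc]
      exact Equiv.swap_apply_of_ne_of_ne (fun e => hc (e ▸ ha)) (fun e => hc (e ▸ hb))
    · change (if y.2 c = a then b else y.2 c) = c
      rw [ih c hc, if_neg (fun e : c = a => hc (e ▸ ha))]

/-- A word over `insert a s` whose self-map misses `a` is a replacement of `a` times a word
over `s`. -/
theorem exists_eq_r_mul_of_miss (h : TransformationRelations t r) {a : α} {s : Finset α}
    (ha : a ∉ s) (ih : ∀ x ∈ pairs t r s, ∀ y ∈ pairs t r s, x.2 = y.2 → x = y)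
    {x : M × Function.End α} (hx : x ∈ pairs t r (insert a s))
    (hmiss : ∀ c ∈ insert a s, x.2 c ≠ a) :
    ∃ i ∈ s, ∃ w ∈ pairs t r s, x = (r a i, replMap a i) * w := by
  have H := h.prod (transformationRelations_maps (α := α))
  have hnf : ∃ j ∈ insert a s, ∃ i ∈ insert a s, ∃ w ∈ pairs t r s,
      x = (t a j, swapMap a j) * ((r a i, replMap a i) * w) := isNormal_of_mem_words H ha hx
  obtain ⟨j, hj, i, hi, w, hw, rfl⟩ := hnf
  have hwa : w.2 a = a := map_eq_of_mem_pairs hw a ha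
  have hm : ∀ c ∈ insert a s, Equiv.swap a j (replMap a i (w.2 c)) ≠ a := hmiss
  by_cases hja : j = a
  · subst hja
    have hij : i ≠ j := by
      have := hm j (by simp)
      simpa [hwa, replMap] using this
    exact ⟨i, (Finset.mem_insert.1 hi).resolve_left hij, w, hw, by rw [H.t_self, one_mul]⟩
  have hjs : j ∈ s := (Finset.mem_insert.1 hj).resolve_left hja
  have hm' : ∀ c ∈ insert a s, replMap a i (w.2 c) ≠ j := by
    intro c hc e
    exact hm c hc (by rw [e, Equiv.swap_apply_right])
  have hij : i ≠ j := by
    have := hm' a (by simp)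
    simpa [hwa, replMap] using this
  have hwj : ∀ c ∈ s, w.2 c ≠ j := by
    intro c hc e
    apply hm' c (Finset.mem_insert_of_mem hc)
    rw [e]; exact if_neg hja
  -- The value `w.2 j` serves as an index in `s` different from `j`; it exists because `w` maps `s`
  -- into `s` and misses `j`.
  have hys : w.2 j ∈ s := map_mem_of_mem_pairs hw j hjs
  have hyj : w.2 j ≠ j := hwj j hjs
  have hya : w.2 j ≠ a := fun e => ha (e ▸ hys)
  -- As `j` is not a value of `w`, replacing `j` afterwards does not change the self-map. The
  -- induction hypothesis lifts this to the words.
  have hwfix : (r j (w.2 j), replMap j (w.2 j)) * w = w := by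
    refine ih _ (mul_mem (r_mem_words _ _ hjs hys) hw) _ hw ?_
    funext c
    change (if w.2 c = j then w.2 j else w.2 c) = w.2 c
    by_cases hc : c ∈ s
    · rw [if_neg (hwj c hc)]
    · rw [map_eq_of_mem_pairs hw c hc, if_neg]
      exact fun e => hc (e ▸ hjs)
  have hu : (r j (w.2 j), replMap j (w.2 j)) * ((r a i, replMap a i) * w) =
      (r a i, replMap a i) * w := by
    rw [← mul_assoc, ← H.r_comm a i j (w.2 j) hja hij.symm hya, mul_assoc, hwfix]
  -- On a word that begins with a replacement of `j`, the transposition `t a j` acts as the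
  -- replacement `r a j`, which combines with `r a i`.
  have hu' : (t a j, swapMap a j) * ((r a i, replMap a i) * w) =
      (r a j, replMap a j) * ((r a i, replMap a i) * w) := by
    rw [← hu, ← mul_assoc, ← H.r_mul_r a j (w.2 j) hyj, mul_assoc]
  rw [hu']
  by_cases hia : i = a
  · subst hia
    exact ⟨j, hjs, w, hw, by rw [H.r_self, one_mul]⟩
  · exact ⟨i, (Finset.mem_insert.1 hi).resolve_left hia, w, hw, by
      rw [← mul_assoc, H.r_absorb _ _ _ hia]⟩

/-- The relations present the monoid of self-maps: a word is determined by its self-map. -/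
theorem pairs_functional (h : TransformationRelations t r) (s : Finset α) :
    ∀ x ∈ pairs t r s, ∀ y ∈ pairs t r s, x.2 = y.2 → x = y := by
  induction s using Finset.induction_on with
  | empty =>
    have : ∀ x ∈ pairs t r (∅ : Finset α), x = 1 := by
      intro x hx
      simpa [pairs, words] using hx
    intro x hx y hy _
    rw [this x hx, this y hy]
  | insert a s ha ih =>
    have H := h.prod (transformationRelations_maps (α := α))
    -- For a map that misses `a`, the factors are read off: `i` is the value at `a`, and `w` agrees
    -- with the map on `s`.
    have miss : ∀ x ∈ pairs t r (insert a s), ∀ y ∈ pairs t r (insert a s), x.2 = y.2 →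
        (∀ c ∈ insert a s, x.2 c ≠ a) → x = y := by
      intro x hx y hy hxy hmx
      have hmy : ∀ c ∈ insert a s, y.2 c ≠ a := hxy ▸ hmx
      obtain ⟨i, hi, w, hw, rfl⟩ := exists_eq_r_mul_of_miss h ha ih hx hmx
      obtain ⟨i', hi', w', hw', rfl⟩ := exists_eq_r_mul_of_miss h ha ih hy hmy
      have hv : ∀ c, (if w.2 c = a then i else w.2 c) = (if w'.2 c = a then i' else w'.2 c) :=
        fun c => congrFun hxy c
      have hii : i = i' := by
        simpa [map_eq_of_mem_pairs hw a ha, map_eq_of_mem_pairs hw' a ha] using hv a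
      have hww : w = w' := by
        refine ih w hw w' hw' ?_
        funext c
        by_cases hc : c ∈ s
        · have h₁ : w.2 c ≠ a := fun e => ha (e ▸ map_mem_of_mem_pairs hw c hc)
          have h₂ : w'.2 c ≠ a := fun e => ha (e ▸ map_mem_of_mem_pairs hw' c hc)
          simpa [h₁, h₂] using hv c
        · rw [map_eq_of_mem_pairs hw c hc, map_eq_of_mem_pairs hw' c hc]
      rw [hii, hww]
    intro x hx y hy hxy
    by_cases hsurj : ∃ j ∈ insert a s, ∀ c ∈ insert a s, x.2 c ≠ j
    · obtain ⟨j, hj, hmj⟩ := hsurj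
      -- If the missed index is `j`, multiplying by the involution `t a j` reduces to the case of
      -- missing `a`.
      have ht : (t a j, swapMap a j) ∈ pairs t r (insert a s) :=
        t_mem_words _ _ (Finset.mem_insert_self a s) hj
      have e := miss _ (mul_mem ht hx) _ (mul_mem ht hy)
        (by rw [Prod.snd_mul, Prod.snd_mul, hxy]) (by
          intro c hc e
          change Equiv.swap a j (x.2 c) = a at e
          exact hmj c hc
            ((Equiv.swap_apply_eq_iff.1 e).trans (Equiv.swap_apply_left a j)))
      have := congrArg ((t a j, swapMap a j) * ·) e
      simpa only [← mul_assoc, H.t_mul_t_self, one_mul] using this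
    · push Not at hsurj
      -- If nothing is missed, the factor `r a i` must be trivial, since for `i ≠ a` the normal form
      -- misses `j`. Then `j` is the value at `a`.
      have norm : ∀ z ∈ pairs t r (insert a s), z.2 = x.2 → ∃ w ∈ pairs t r s,
          z = (t a (x.2 a), swapMap a (x.2 a)) * w := by
        intro z hz hzx
        have hnf : ∃ j ∈ insert a s, ∃ i ∈ insert a s, ∃ w ∈ pairs t r s,
            z = (t a j, swapMap a j) * ((r a i, replMap a i) * w) :=
          isNormal_of_mem_words H ha hz
        obtain ⟨j, hj, i, hi, w, hw, rfl⟩ := hnf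
        have hwa : w.2 a = a := map_eq_of_mem_pairs hw a ha
        have hv : ∀ c, x.2 c = Equiv.swap a j (if w.2 c = a then i else w.2 c) :=
          fun c => (congrFun hzx c).symm
        have hia : i = a := by
          by_contra hia
          obtain ⟨c, hc, e⟩ := hsurj j hj
          rw [hv c, Equiv.swap_apply_eq_iff, Equiv.swap_apply_right] at e
          split_ifs at e <;> contradiction
        subst hia
        refine ⟨w, hw, ?_⟩
        have : x.2 i = j := by rw [hv i, hwa, if_pos rfl, Equiv.swap_apply_left]
        rw [this, H.r_self, one_mul]
      obtain ⟨w, hw, e⟩ := norm x hx rfl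
      obtain ⟨w', hw', e'⟩ := norm y hy hxy.symm
      have hww : w = w' := by
        refine ih w hw w' hw' ?_
        have h₂ : swapMap a (x.2 a) * w.2 = swapMap a (x.2 a) * w'.2 := by
          have h₁ := congrArg Prod.snd e
          have h₂ := congrArg Prod.snd e'
          exact h₁.symm.trans (hxy.trans h₂)
        funext c
        exact (Equiv.swap a (x.2 a)).injective (congrFun h₂ c)
      rw [e, e', hww]

end TransformationRelations

/-! ### The operations of an algebra satisfy the relations. -/

section Action

variable {n : ℕ} {A : Type u} [BooleanAlgebra A] [SA n A]

/-- The operation `s_{ij}`, the identity for `i = j`. -/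
def trEnd (A : Type u) [BooleanAlgebra A] [SA n A] (i j : Fin n) : Function.End A :=
  fun x => if h : i ≠ j then tr i j h x else x

/-- The operation `s^i_j`, the identity for `i = j`. -/
def rpEnd (A : Type u) [BooleanAlgebra A] [SA n A] (i j : Fin n) : Function.End A :=
  fun x => if h : i ≠ j then rp i j h x else x

theorem trEnd_apply {i j : Fin n} (h : i ≠ j) (x : A) : trEnd A i j x = tr i j h x := dif_pos h

theorem rpEnd_apply {i j : Fin n} (h : i ≠ j) (x : A) : rpEnd A i j x = rp i j h x := dif_pos h

theorem trEnd_self (i : Fin n) : trEnd A i i = 1 := by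
  funext x; exact dif_neg (by simp)

theorem rpEnd_self (i : Fin n) : rpEnd A i i = 1 := by
  funext x; exact dif_neg (by simp)

theorem trEnd_symm (i j : Fin n) : trEnd A i j = trEnd A j i := by
  by_cases h : i = j
  · rw [h]
  · funext x; rw [trEnd_apply h, trEnd_apply (Ne.symm h), tr_symm]

theorem trEnd_mul_self (i j : Fin n) : trEnd A i j * trEnd A i j = 1 := by
  by_cases h : i = j
  · rw [h, trEnd_self, one_mul]
  · funext x
    change trEnd A i j (trEnd A i j x) = x
    rw [trEnd_apply h, trEnd_apply h, tr_tr]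

/-- Turns the axioms, stated as conjugations by an involution, into rules for moving a transposition
to the right. -/
theorem eq_mul_trEnd {i j : Fin n} {x y : Function.End A}
    (h : trEnd A i j * (x * trEnd A i j) = y) : trEnd A i j * x = y * trEnd A i j := by
  rw [← h, mul_assoc, mul_assoc, trEnd_mul_self, mul_one]

theorem trEnd_mul_right {i j k : Fin n} (hij : i ≠ j) (hjk : j ≠ k) (hik : i ≠ k) :
    trEnd A i j * trEnd A j k = trEnd A i k * trEnd A i j := by
  apply eq_mul_trEnd
  funext x
  change trEnd A i j (trEnd A j k (trEnd A i j x)) = trEnd A i k x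
  rw [trEnd_apply hij, trEnd_apply hij, trEnd_apply hjk, trEnd_apply hik, tr_conj]

theorem trEnd_mul_disjoint {i j k l : Fin n} (hij : i ≠ j) (hik : i ≠ k) (hil : i ≠ l)
    (hjk : j ≠ k) (hjl : j ≠ l) (hkl : k ≠ l) :
    trEnd A i j * trEnd A k l = trEnd A k l * trEnd A i j := by
  funext x
  change trEnd A i j (trEnd A k l x) = trEnd A k l (trEnd A i j x)
  simp only [trEnd_apply hij, trEnd_apply hkl]
  exact tr_comm i j k l hij hik hil hjk hjl hkl x

theorem trEnd_mul_rpEnd_disjoint {i j k l : Fin n} (hij : i ≠ j) (hik : i ≠ k) (hil : i ≠ l)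
    (hjk : j ≠ k) (hjl : j ≠ l) (hkl : k ≠ l) :
    trEnd A k l * rpEnd A j i = rpEnd A j i * trEnd A k l := by
  apply eq_mul_trEnd
  funext x
  change trEnd A k l (rpEnd A j i (trEnd A k l x)) = rpEnd A j i x
  simp only [trEnd_apply hkl, rpEnd_apply hij.symm]
  exact conj_disjoint i j k l hij hik hil hjk hjl hkl x

theorem trEnd_mul_rpEnd_source {i j k : Fin n} (hij : i ≠ j) (hjk : j ≠ k) (hik : i ≠ k) :
    trEnd A j k * rpEnd A j i = rpEnd A k i * trEnd A j k := by
  apply eq_mul_trEnd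
  funext x
  change trEnd A j k (rpEnd A j i (trEnd A j k x)) = rpEnd A k i x
  simp only [trEnd_apply hjk, rpEnd_apply hij.symm, rpEnd_apply hik.symm]
  exact conj_source i j k hij hjk hik x

theorem trEnd_mul_rpEnd_target {i j k : Fin n} (hij : i ≠ j) (hjk : j ≠ k) (hik : i ≠ k) :
    trEnd A k i * rpEnd A j i = rpEnd A j k * trEnd A k i := by
  apply eq_mul_trEnd
  funext x
  change trEnd A k i (rpEnd A j i (trEnd A k i x)) = rpEnd A j k x
  simp only [trEnd_apply hik.symm, rpEnd_apply hij.symm, rpEnd_apply hjk]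
  exact conj_target i j k hij hjk hik x

theorem trEnd_mul_rpEnd_swap (i j : Fin n) :
    trEnd A i j * rpEnd A j i = rpEnd A i j * trEnd A i j := by
  by_cases hij : i = j
  · subst hij; rw [trEnd_self, rpEnd_self]
  apply eq_mul_trEnd
  funext x
  change trEnd A i j (rpEnd A j i (trEnd A i j x)) = rpEnd A i j x
  simp only [trEnd_apply hij, rpEnd_apply hij, rpEnd_apply (Ne.symm hij)]
  exact conj_swap i j hij x

theorem rpEnd_mul_trEnd (i j : Fin n) : rpEnd A j i * trEnd A i j = rpEnd A j i := by
  by_cases hij : i = j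
  · subst hij; rw [trEnd_self, rpEnd_self, one_mul]
  funext x
  change rpEnd A j i (trEnd A i j x) = rpEnd A j i x
  simp only [trEnd_apply hij, rpEnd_apply (Ne.symm hij)]
  exact rp_tr i j hij x

theorem trEnd_mul_trEnd (a b c d : Fin n) :
    trEnd A a b * trEnd A c d =
      trEnd A (Equiv.swap a b c) (Equiv.swap a b d) * trEnd A a b := by
  by_cases hab : a = b
  · subst hab; simp [trEnd_self]
  by_cases hcd : c = d
  · subst hcd; simp [trEnd_self]
  have left : ∀ d, d ≠ a → d ≠ b → trEnd A a b * trEnd A a d = trEnd A b d * trEnd A a b := by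
    intro d hda hdb
    rw [trEnd_symm a b, trEnd_mul_right (Ne.symm hab) hda.symm hdb.symm]
  by_cases hca : c = a
  · subst hca
    by_cases hdb : d = b
    · subst hdb; simp [trEnd_symm d c]
    · rw [Equiv.swap_apply_left, Equiv.swap_apply_of_ne_of_ne (Ne.symm hcd) hdb,
        left d (Ne.symm hcd) hdb]
  by_cases hcb : c = b
  · subst hcb
    by_cases hda : d = a
    · subst hda; simp [trEnd_symm d c]
    · rw [Equiv.swap_apply_right, Equiv.swap_apply_of_ne_of_ne hda (Ne.symm hcd),
        trEnd_mul_right hab hcd (Ne.symm hda)]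
  rw [Equiv.swap_apply_of_ne_of_ne hca hcb]
  by_cases hda : d = a
  · subst hda
    rw [Equiv.swap_apply_left, trEnd_symm c d, trEnd_symm c b, left c hca hcb]
  by_cases hdb : d = b
  · subst hdb
    rw [Equiv.swap_apply_right, trEnd_symm c d, trEnd_symm c a,
      trEnd_mul_right hab (Ne.symm hcd) (Ne.symm hca)]
  rw [Equiv.swap_apply_of_ne_of_ne hda hdb]
  exact trEnd_mul_disjoint hab (Ne.symm hca) (Ne.symm hda) (Ne.symm hcb) (Ne.symm hdb) hcd

theorem trEnd_mul_rpEnd (a b c d : Fin n) :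
    trEnd A a b * rpEnd A c d =
      rpEnd A (Equiv.swap a b c) (Equiv.swap a b d) * trEnd A a b := by
  by_cases hab : a = b
  · subst hab; simp [trEnd_self]
  by_cases hcd : c = d
  · subst hcd; simp [rpEnd_self]
  by_cases hca : c = a
  · subst hca
    by_cases hdb : d = b
    · subst hdb
      rw [Equiv.swap_apply_left, Equiv.swap_apply_right, trEnd_symm, trEnd_mul_rpEnd_swap]
    · rw [Equiv.swap_apply_left, Equiv.swap_apply_of_ne_of_ne (Ne.symm hcd) hdb,
        trEnd_mul_rpEnd_source (Ne.symm hcd) hab hdb]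
  by_cases hcb : c = b
  · subst hcb
    by_cases hda : d = a
    · subst hda
      rw [Equiv.swap_apply_left, Equiv.swap_apply_right, trEnd_mul_rpEnd_swap]
    · rw [Equiv.swap_apply_right, Equiv.swap_apply_of_ne_of_ne hda (Ne.symm hcd),
        trEnd_symm, trEnd_mul_rpEnd_source (Ne.symm hcd) (Ne.symm hab) hda]
  rw [Equiv.swap_apply_of_ne_of_ne hca hcb]
  by_cases hda : d = a
  · subst hda
    rw [Equiv.swap_apply_left, trEnd_symm, trEnd_mul_rpEnd_target (Ne.symm hcd) hcb hab]
  by_cases hdb : d = b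
  · subst hdb
    rw [Equiv.swap_apply_right, trEnd_mul_rpEnd_target (Ne.symm hcd) hca (Ne.symm hab)]
  rw [Equiv.swap_apply_of_ne_of_ne hda hdb]
  exact trEnd_mul_rpEnd_disjoint (Ne.symm hcd) hda hdb hca hcb hab

theorem trEnd_mul_rpEnd_self (a b : Fin n) : trEnd A a b * rpEnd A a b = rpEnd A b a := by
  rw [trEnd_symm, trEnd_mul_rpEnd_swap, trEnd_symm, rpEnd_mul_trEnd]

theorem rpEnd_comm {a i b c : Fin n} (hba : b ≠ a) (hbi : b ≠ i) (hca : c ≠ a) :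
    rpEnd A a i * rpEnd A b c = rpEnd A b c * rpEnd A a i := by
  by_cases hai : a = i
  · subst hai; rw [rpEnd_self, one_mul, mul_one]
  by_cases hbc : b = c
  · subst hbc; rw [rpEnd_self, one_mul, mul_one]
  funext x
  change rpEnd A a i (rpEnd A b c x) = rpEnd A b c (rpEnd A a i x)
  by_cases hci : c = i
  · subst hci
    simp only [rpEnd_apply hai, rpEnd_apply hbc]
    exact rp_comm_target c a b hca hba.symm (Ne.symm hbc) x
  · simp only [rpEnd_apply hai, rpEnd_apply hbc]
    exact rp_comm i a b c (Ne.symm hai) hbi.symm (Ne.symm hci) hba.symm hca.symm hbc x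

theorem rpEnd_chain {a b c : Fin n} (hab : a ≠ b) (hac : a ≠ c) :
    rpEnd A b c * rpEnd A a b = rpEnd A a c * rpEnd A b c := by
  by_cases hbc : b = c
  · subst hbc; rw [rpEnd_self, one_mul, mul_one]
  funext x
  change rpEnd A b c (rpEnd A a b x) = rpEnd A a c (rpEnd A b c x)
  simp only [rpEnd_apply hab, rpEnd_apply hbc, rpEnd_apply hac]
  exact (rp_chain c b a (Ne.symm hbc) hab.symm hac.symm x).symm

theorem rpEnd_absorb {a c i : Fin n} (hia : i ≠ a) :
    rpEnd A a c * rpEnd A a i = rpEnd A a i := by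
  by_cases hac : a = c
  · subst hac; rw [rpEnd_self, one_mul]
  funext x
  change rpEnd A a c (rpEnd A a i x) = rpEnd A a i x
  by_cases hci : c = i
  · subst hci
    simp only [rpEnd_apply hac]
    exact rp_idem c a (Ne.symm hac) x
  · simp only [rpEnd_apply hac, rpEnd_apply hia.symm]
    exact rp_absorb c a i (Ne.symm hac) hia.symm hci x

theorem rpEnd_mul_rpEnd {a b c : Fin n} (hcb : c ≠ b) :
    rpEnd A a b * rpEnd A b c = trEnd A a b * rpEnd A b c := by
  by_cases hab : a = b
  · subst hab; rw [rpEnd_self, trEnd_self]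
  by_cases hca : c = a
  · subst hca
    rw [trEnd_symm, trEnd_mul_rpEnd_self]
    funext x
    change rpEnd A c b (rpEnd A b c x) = rpEnd A c b x
    simp only [rpEnd_apply hcb, rpEnd_apply hcb.symm]
    exact rp_rp_swap b c hcb.symm x
  · rw [trEnd_symm, trEnd_mul_rpEnd, Equiv.swap_apply_left,
      Equiv.swap_apply_of_ne_of_ne hcb hca]
    funext x
    change rpEnd A a b (rpEnd A b c x) = rpEnd A a c (trEnd A b a x)
    simp only [rpEnd_apply hab, rpEnd_apply hcb.symm, rpEnd_apply (Ne.symm hca),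
      trEnd_apply (Ne.symm hab)]
    exact rp_rp_eq_rp_tr b a c (Ne.symm hab) (Ne.symm hca) hcb.symm x

theorem transformationRelations (n : ℕ) (A : Type u) [BooleanAlgebra A] [SA n A] :
    TransformationRelations (trEnd (n := n) A) (rpEnd A) where
  t_self := trEnd_self
  r_self := rpEnd_self
  t_symm := trEnd_symm
  t_mul_t_self := trEnd_mul_self
  t_mul_t := trEnd_mul_trEnd
  t_mul_r := trEnd_mul_rpEnd
  t_mul_r_self := trEnd_mul_rpEnd_self
  r_comm _ _ _ _ := rpEnd_comm
  r_chain _ _ _ := rpEnd_chain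
  r_absorb _ _ _ := rpEnd_absorb
  r_mul_r _ _ _ := rpEnd_mul_rpEnd

/-- The monoid of all compositions of the operations, paired with the self-maps of `Fin n`
that they denote. -/
abbrev operations (n : ℕ) (A : Type u) [BooleanAlgebra A] [SA n A] :
    Submonoid (Function.End A × Function.End (Fin n)) :=
  TransformationRelations.pairs (trEnd A) (rpEnd A) Finset.univ

/-- The self-map that a composition of operations denotes. -/
def underlyingMap (w : operations n A) : Fin n → Fin n := w.1.2

theorem underlyingMap_injective :
    Function.Injective (underlyingMap (n := n) (A := A)) := fun x y h =>
  Subtype.ext ((transformationRelations n A).pairs_functional _ x.1 x.2 y.1 y.2 h)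

instance finite_operations : Finite (operations n A) :=
  Finite.of_injective _ underlyingMap_injective

theorem card_operations_le : Nat.card (operations n A) ≤ n ^ n := by
  simpa using Nat.card_le_card_of_injective _ (underlyingMap_injective (n := n) (A := A))

theorem exists_mul_tr (w : operations n A) (i j : Fin n) (h : i ≠ j) :
    ∃ w' : operations n A, ∀ x, w.1.1 (tr i j h x) = w'.1.1 x :=
  ⟨w * ⟨_, TransformationRelations.t_mem_words _ _ (Finset.mem_univ i) (Finset.mem_univ j)⟩,
    fun x => congrArg w.1.1 (trEnd_apply h x).symm⟩

theorem exists_mul_rp (w : operations n A) (i j : Fin n) (h : i ≠ j) :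
    ∃ w' : operations n A, ∀ x, w.1.1 (rp i j h x) = w'.1.1 x :=
  ⟨w * ⟨_, TransformationRelations.r_mem_words _ _ (Finset.mem_univ i) (Finset.mem_univ j)⟩,
    fun x => congrArg w.1.1 (rpEnd_apply h x).symm⟩

theorem operations_map_inf_compl {w : Function.End A × Function.End (Fin n)}
    (hw : w ∈ operations n A) :
    (∀ x y, w.1 (x ⊓ y) = w.1 x ⊓ w.1 y) ∧ ∀ x, w.1 xᶜ = (w.1 x)ᶜ := by
  induction hw using Submonoid.closure_induction_left with
  | one => exact ⟨fun _ _ => rfl, fun _ => rfl⟩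
  | mul_left g hg y _ ih =>
    have hg' : (∀ x y, g.1 (x ⊓ y) = g.1 x ⊓ g.1 y) ∧ ∀ x, g.1 xᶜ = (g.1 x)ᶜ := by
      obtain ⟨i, -, j, -, rfl | rfl⟩ := hg <;> by_cases h : i = j
      · subst h
        simp [trEnd_self, Function.End.one_def]
      · simp [trEnd_apply h, tr_inf, tr_compl]
      · subst h
        simp [rpEnd_self, Function.End.one_def]
      · simp [rpEnd_apply h, rp_inf, rp_compl]
    refine ⟨fun x z => ?_, fun x => ?_⟩
    · change g.1 (y.1 (x ⊓ z)) = g.1 (y.1 x) ⊓ g.1 (y.1 z)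
      rw [ih.1, hg'.1]
    · change g.1 (y.1 xᶜ) = (g.1 (y.1 x))ᶜ
      rw [ih.2, hg'.2]

end Action

/-! ### Points of Boolean algebras and their separation. -/

/-- A point of the dual space of a Boolean algebra: a homomorphism to the truth values. -/
@[ext]
structure Point (A : Type u) [BooleanAlgebra A] where
  /-- The elements that contain the point. -/
  mem : A → Prop
  mem_inf : ∀ x y, mem (x ⊓ y) ↔ mem x ∧ mem y
  mem_compl : ∀ x, mem xᶜ ↔ ¬ mem x

namespace Point

variable {A : Type u} {B : Type v} [BooleanAlgebra A] [BooleanAlgebra B]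

theorem mono (P : Point A) {x y : A} (h : x ≤ y) (hx : P.mem x) : P.mem y := by
  rw [← inf_eq_left.2 h, P.mem_inf] at hx
  exact hx.2

theorem not_mem_bot (P : Point A) : ¬ P.mem ⊥ := by
  have h := P.mem_inf ⊥ ⊥ᶜ
  rw [inf_compl_eq_bot, P.mem_compl] at h
  tauto

/-- The point that a Boolean homomorphism `A → B` induces from a point of `B`. -/
def comap (P : Point B) (f : A → B) (hf : ∀ x y, f (x ⊓ y) = f x ⊓ f y)
    (hf' : ∀ x, f xᶜ = (f x)ᶜ) : Point A where
  mem x := P.mem (f x)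
  mem_inf x y := by rw [hf, P.mem_inf]
  mem_compl x := by rw [hf', P.mem_compl]

/-- Separation of a filter base from an ideal base by a point. -/
theorem exists_separating {F I : Set A} (hF : F.Nonempty) (hI : I.Nonempty)
    (hF' : ∀ x ∈ F, ∀ y ∈ F, x ⊓ y ∈ F) (hI' : ∀ x ∈ I, ∀ y ∈ I, x ⊔ y ∈ I)
    (h : ∀ x ∈ F, ∀ y ∈ I, ¬ x ≤ y) :
    ∃ P : Point A, (∀ x ∈ F, P.mem x) ∧ ∀ y ∈ I, ¬ P.mem y := by
  have isF : Order.IsPFilter {z | ∃ x ∈ F, x ≤ z} := by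
    refine Order.IsPFilter.of_def ?_ ?_ ?_
    · obtain ⟨x, hx⟩ := hF
      exact ⟨x, x, hx, le_rfl⟩
    · rintro z ⟨x, hx, hxz⟩ z' ⟨x', hx', hxz'⟩
      exact ⟨x ⊓ x', ⟨_, hF' x hx x' hx', le_rfl⟩, inf_le_left.trans hxz, inf_le_right.trans hxz'⟩
    · rintro z z' hzz' ⟨x, hx, hxz⟩
      exact ⟨x, hx, hxz.trans hzz'⟩
  have isI : Order.IsIdeal {z | ∃ y ∈ I, z ≤ y} := by
    refine ⟨?_, ?_, ?_⟩
    · rintro z z' hzz' ⟨y, hy, hzy⟩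
      exact ⟨y, hy, hzz'.trans hzy⟩
    · obtain ⟨y, hy⟩ := hI
      exact ⟨y, y, hy, le_rfl⟩
    · rintro z ⟨y, hy, hzy⟩ z' ⟨y', hy', hzy'⟩
      exact ⟨y ⊔ y', ⟨_, hI' y hy y' hy', le_rfl⟩, hzy.trans le_sup_left, hzy'.trans le_sup_right⟩
  obtain ⟨J, hJ, hIJ, hFJ⟩ := DistribLattice.prime_ideal_of_disjoint_filter_ideal
    (F := isF.toPFilter) (I := isI.toIdeal) (Set.disjoint_left.2 (by
      rintro z ⟨x, hx, hxz⟩ ⟨y, hy, hzy⟩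
      exact h x hx y hy (hxz.trans hzy)))
  refine ⟨⟨fun x => x ∉ J, fun x y => ?_, fun x => ?_⟩, fun x hx => ?_, fun y hy => ?_⟩
  · rw [← not_or, not_iff_not]
    exact ⟨hJ.mem_or_mem, fun h => h.elim (J.lower inf_le_left) (J.lower inf_le_right)⟩
  · refine ⟨fun hx => not_not.2 (hJ.mem_or_compl_mem.resolve_right hx), fun hx hx' => ?_⟩
    apply hJ.toIsProper.top_notMem
    rw [← sup_compl_eq_top (x := x)]
    exact J.sup_mem (not_not.1 hx) hx'
  · exact Set.disjoint_left.1 hFJ ⟨x, hx, le_rfl⟩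
  · exact not_not.2 (hIJ ⟨y, hy, le_rfl⟩)

theorem le_of_forall_mem {x y : A} (h : ∀ P : Point A, P.mem x → P.mem y) : x ≤ y := by
  by_contra hxy
  obtain ⟨P, hx, hy⟩ := exists_separating (F := {x}) (I := {y}) ⟨x, rfl⟩ ⟨y, rfl⟩
    (by simp) (by simp) (by simpa using hxy)
  exact hy y rfl (h P (hx x rfl))

end Point

/-! ### Local finiteness and the cardinality bound. -/

section LocallyFinite

variable {n : ℕ} {A : Type u} [BooleanAlgebra A] [SA n A]

/-- The values of a point at the images of the elements of `X` under all operations. -/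
def trace (n : ℕ) [SA n A] (X : Set A) (P : Point A) : X × operations n A → Prop :=
  fun z => P.mem (z.2.1.1 z.1)

/-- The elements at which `P` and `Q` agree after every composite operation form a subalgebra
containing `X`. Quantifying over all composites makes this set closed under the operations, and the
composite `1` gives the claim. -/
theorem mem_iff_of_trace_eq {X : Set A} {P Q : Point A} (h : trace n X P = trace n X Q) {a : A}
    (ha : a ∈ Sg n X) : P.mem a ↔ Q.mem a := by
  have hS : IsSubalgebra n
      {a : A | ∀ w : operations n A, P.mem (w.1.1 a) ↔ Q.mem (w.1.1 a)} := by
    have hinf : ∀ x ∈ {a : A | ∀ w : operations n A, P.mem (w.1.1 a) ↔ Q.mem (w.1.1 a)},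
        ∀ y ∈ {a : A | ∀ w : operations n A, P.mem (w.1.1 a) ↔ Q.mem (w.1.1 a)},
        x ⊓ y ∈ {a : A | ∀ w : operations n A, P.mem (w.1.1 a) ↔ Q.mem (w.1.1 a)} := by
      intro x hx y hy w
      rw [(operations_map_inf_compl w.2).1, P.mem_inf, Q.mem_inf, hx w, hy w]
    refine ⟨fun w => ?_, hinf, fun x hx w => ?_, fun i j hij x hx w => ?_, fun i j hij x hx w => ?_⟩
    · have hw : w.1.1 (⊥ : A) = ⊥ := by
        obtain ⟨h₁, h₂⟩ := operations_map_inf_compl w.2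
        have e := h₁ ⊥ ⊥ᶜ
        rwa [h₂, inf_compl_eq_bot, inf_compl_eq_bot] at e
      rw [hw]
      exact iff_of_false P.not_mem_bot Q.not_mem_bot
    · rw [(operations_map_inf_compl w.2).2, P.mem_compl, Q.mem_compl, hx w]
    · obtain ⟨w', hw'⟩ := exists_mul_tr w i j hij
      rw [hw']; exact hx w'
    · obtain ⟨w', hw'⟩ := exists_mul_rp w i j hij
      rw [hw']; exact hx w'
  exact Set.mem_sInter.1 ha _ ⟨hS, fun x hx w => iff_of_eq (congrFun h (⟨x, hx⟩, w))⟩ 1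

/-- If `P` contains `a`, then some `Q` containing `b` has the same trace; as `b` is generated by
`X`, also `P` contains `b`. Hence `a ≤ b`, and symmetrically. -/
theorem traces_injective (X : Set A) :
    Function.Injective (fun a : Sg n X => trace n X '' {P | P.mem (a : A)}) := by
  have key : ∀ a b : Sg n X, trace n X '' {P | P.mem (a : A)} = trace n X '' {P | P.mem (b : A)} →
      (a : A) ≤ b := by
    intro a b hab
    refine Point.le_of_forall_mem fun P hP => ?_
    have hP' : trace n X P ∈ trace n X '' {P | P.mem (b : A)} := hab ▸ ⟨P, hP, rfl⟩
    obtain ⟨Q, hQ, e⟩ := hP'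
    exact (mem_iff_of_trace_eq e b.2).1 hQ
  exact fun a b hab => Subtype.ext (le_antisymm (key a b hab) (key b a hab.symm))

theorem finite_Sg {X : Set A} (hX : X.Finite) : (Sg n X).Finite := by
  have := hX.to_subtype
  exact Set.finite_coe_iff.1 (Finite.of_injective _ (traces_injective (n := n) X))

theorem card_Sg_le {X : Set A} (hX : X.Finite) :
    Nat.card (Sg n X) ≤ 2 ^ 2 ^ (Nat.card X * n ^ n) := by
  have := hX.to_subtype
  have h₁ := Nat.card_le_card_of_injective _ (traces_injective (n := n) X)
  have h₂ : Nat.card (Set (X × operations n A → Prop)) =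
      2 ^ 2 ^ (Nat.card X * Nat.card (operations n A)) := by
    change Nat.card ((X × operations n A → Prop) → Prop) = _
    simp [Nat.card_fun, Nat.card_prod]
  rw [h₂] at h₁
  exact h₁.trans (Nat.pow_le_pow_right two_pos (Nat.pow_le_pow_right two_pos
    (Nat.mul_le_mul_left _ card_operations_le)))

end LocallyFinite

/-! ### Superamalgamation through the pullback of dual spaces. -/

section Amalgamation

variable {n : ℕ} {A B C : Type u} [BooleanAlgebra A] [BooleanAlgebra B] [BooleanAlgebra C]
  [SA n A] [SA n B] [SA n C]

theorem IsMono.map_bot {f : A → B} (hf : IsMono n f) : f ⊥ = ⊥ := by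
  rw [← inf_compl_eq_bot (a := (⊥ : A)), hf.map_inf, hf.map_compl, inf_compl_eq_bot]

theorem IsMono.map_sup {f : A → B} (hf : IsMono n f) (x y : A) : f (x ⊔ y) = f x ⊔ f y := by
  rw [← compl_compl (x ⊔ y), compl_sup, hf.map_compl, hf.map_inf, hf.map_compl, hf.map_compl,
    compl_inf, compl_compl, compl_compl]

theorem IsMono.map_top {f : A → B} (hf : IsMono n f) : f ⊤ = ⊤ := by
  rw [← compl_bot, hf.map_compl, hf.map_bot, compl_bot]

/-- The pullback of the dual spaces along `p : A → B` and `q : A → C`. -/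
def Pullback {A B C : Type u} [BooleanAlgebra B] [BooleanAlgebra C] (p : A → B)
    (q : A → C) : Type u :=
  {z : Point B × Point C // ∀ a, z.1.mem (p a) ↔ z.2.mem (q a)}

namespace Pullback

variable {p : A → B} {q : A → C}

/-- The action of `s_{ij}` on the pullback. -/
def trMap (hp : IsMono n p) (hq : IsMono n q) (i j : Fin n) (h : i ≠ j) (z : Pullback p q) :
    Pullback p q :=
  ⟨(z.1.1.comap (tr i j h) (tr_inf i j h) (tr_compl i j h),
    z.1.2.comap (tr i j h) (tr_inf i j h) (tr_compl i j h)), fun a => by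
      change z.1.1.mem (tr i j h (p a)) ↔ z.1.2.mem (tr i j h (q a))
      rw [← hp.map_tr, ← hq.map_tr, z.2]⟩

/-- The action of `s^i_j` on the pullback. -/
def rpMap (hp : IsMono n p) (hq : IsMono n q) (i j : Fin n) (h : i ≠ j) (z : Pullback p q) :
    Pullback p q :=
  ⟨(z.1.1.comap (rp i j h) (rp_inf i j h) (rp_compl i j h),
    z.1.2.comap (rp i j h) (rp_inf i j h) (rp_compl i j h)), fun a => by
      change z.1.1.mem (rp i j h (p a)) ↔ z.1.2.mem (rp i j h (q a))
      rw [← hp.map_rp, ← hq.map_rp, z.2]⟩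

theorem mem_congr {A : Type u} {p : A → B} {q : A → C} {z z' : Pullback p q}
    (Y : Set (Pullback p q))
    (hB : ∀ b, z.1.1.mem b = z'.1.1.mem b) (hC : ∀ c, z.1.2.mem c = z'.1.2.mem c) :
    z ∈ Y ↔ z' ∈ Y := by
  have : z = z' := Subtype.ext (Prod.ext (Point.ext (funext hB)) (Point.ext (funext hC)))
  rw [this]

/-- The complex algebra of the pullback. -/
abbrev complexAlgebra (hp : IsMono n p) (hq : IsMono n q) : SA n (Set (Pullback p q)) where
  tr i j h Y := {z | trMap hp hq i j h z ∈ Y}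
  rp i j h Y := {z | rpMap hp hq i j h z ∈ Y}
  tr_inf _ _ _ _ _ := rfl
  tr_compl _ _ _ _ := rfl
  rp_inf _ _ _ _ _ := rfl
  rp_compl _ _ _ _ := rfl
  -- Composition is reversed twice, from algebra to points and from points to sets, so each equation
  -- for `Y` reduces to the same equation in `B` and in `C`.
  tr_symm i j h Y := Set.ext fun z => mem_congr Y
    (fun b => congrArg z.1.1.mem (tr_symm i j h b))
    (fun c => congrArg z.1.2.mem (tr_symm i j h c))
  tr_tr i j h Y := Set.ext fun z => mem_congr Y
    (fun b => congrArg z.1.1.mem (tr_tr i j h b))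
    (fun c => congrArg z.1.2.mem (tr_tr i j h c))
  tr_conj i j k h₁ h₂ h₃ Y := Set.ext fun z => mem_congr Y
    (fun b => congrArg z.1.1.mem (tr_conj i j k h₁ h₂ h₃ b))
    (fun c => congrArg z.1.2.mem (tr_conj i j k h₁ h₂ h₃ c))
  tr_comm i j k l h₁ h₂ h₃ h₄ h₅ h₆ Y := Set.ext fun z => mem_congr Y
    (fun b => congrArg z.1.1.mem (tr_comm i j k l h₁ h₂ h₃ h₄ h₅ h₆ b))
    (fun c => congrArg z.1.2.mem (tr_comm i j k l h₁ h₂ h₃ h₄ h₅ h₆ c))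
  conj_disjoint i j k l h₁ h₂ h₃ h₄ h₅ h₆ Y := Set.ext fun z => mem_congr Y
    (fun b => congrArg z.1.1.mem (conj_disjoint i j k l h₁ h₂ h₃ h₄ h₅ h₆ b))
    (fun c => congrArg z.1.2.mem (conj_disjoint i j k l h₁ h₂ h₃ h₄ h₅ h₆ c))
  conj_source i j k h₁ h₂ h₃ Y := Set.ext fun z => mem_congr Y
    (fun b => congrArg z.1.1.mem (conj_source i j k h₁ h₂ h₃ b))
    (fun c => congrArg z.1.2.mem (conj_source i j k h₁ h₂ h₃ c))
  conj_target i j k h₁ h₂ h₃ Y := Set.ext fun z => mem_congr Y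
    (fun b => congrArg z.1.1.mem (conj_target i j k h₁ h₂ h₃ b))
    (fun c => congrArg z.1.2.mem (conj_target i j k h₁ h₂ h₃ c))
  conj_swap i j h Y := Set.ext fun z => mem_congr Y
    (fun b => congrArg z.1.1.mem (conj_swap i j h b))
    (fun c => congrArg z.1.2.mem (conj_swap i j h c))
  rp_comm i j k l h₁ h₂ h₃ h₄ h₅ h₆ Y := Set.ext fun z => mem_congr Y
    (fun b => congrArg z.1.1.mem (rp_comm i j k l h₁ h₂ h₃ h₄ h₅ h₆ b))
    (fun c => congrArg z.1.2.mem (rp_comm i j k l h₁ h₂ h₃ h₄ h₅ h₆ c))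
  rp_comm_target i j k h₁ h₂ h₃ Y := Set.ext fun z => mem_congr Y
    (fun b => congrArg z.1.1.mem (rp_comm_target i j k h₁ h₂ h₃ b))
    (fun c => congrArg z.1.2.mem (rp_comm_target i j k h₁ h₂ h₃ c))
  rp_chain i j k h₁ h₂ h₃ Y := Set.ext fun z => mem_congr Y
    (fun b => congrArg z.1.1.mem (rp_chain i j k h₁ h₂ h₃ b))
    (fun c => congrArg z.1.2.mem (rp_chain i j k h₁ h₂ h₃ c))
  rp_rp_eq_rp_tr i j k h₁ h₂ h₃ Y := Set.ext fun z => mem_congr Y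
    (fun b => congrArg z.1.1.mem (rp_rp_eq_rp_tr i j k h₁ h₂ h₃ b))
    (fun c => congrArg z.1.2.mem (rp_rp_eq_rp_tr i j k h₁ h₂ h₃ c))
  rp_absorb i j k h₁ h₂ h₃ Y := Set.ext fun z => mem_congr Y
    (fun b => congrArg z.1.1.mem (rp_absorb i j k h₁ h₂ h₃ b))
    (fun c => congrArg z.1.2.mem (rp_absorb i j k h₁ h₂ h₃ c))
  rp_idem i j h Y := Set.ext fun z => mem_congr Y
    (fun b => congrArg z.1.1.mem (rp_idem i j h b))
    (fun c => congrArg z.1.2.mem (rp_idem i j h c))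
  rp_rp_swap i j h Y := Set.ext fun z => mem_congr Y
    (fun b => congrArg z.1.1.mem (rp_rp_swap i j h b))
    (fun c => congrArg z.1.2.mem (rp_rp_swap i j h c))
  rp_tr i j h Y := Set.ext fun z => mem_congr Y
    (fun b => congrArg z.1.1.mem (rp_tr i j h b))
    (fun c => congrArg z.1.2.mem (rp_tr i j h c))

theorem exists_mem_not_mem (hp : IsMono n p) (hq : IsMono n q) {b : B} {c : C}
    (h : ∀ a, b ≤ p a → ¬ q a ≤ c) : ∃ z : Pullback p q, z.1.1.mem b ∧ ¬ z.1.2.mem c := by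
  have mono_q : ∀ {x y : A}, x ≤ y → q x ≤ q y := fun {x y} hxy => by
    rw [← inf_eq_left.2 hxy, hq.map_inf]; exact inf_le_right
  -- Without an interpolant, the filter of all `a` with `b ≤ p a` is disjoint from the ideal of all
  -- `a` with `q a ≤ c`. The separating point `W` of `A` will be the common restriction.
  obtain ⟨W, hWb, hWc⟩ := Point.exists_separating (F := {a | b ≤ p a}) (I := {a | q a ≤ c})
    ⟨⊤, by simp [hp.map_top]⟩ ⟨⊥, by simp [hq.map_bot]⟩
    (fun x hx y hy => by
      simp only [Set.mem_ofPred_eq, hp.map_inf]; exact le_inf hx hy)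
    (fun x hx y hy => by
      simp only [Set.mem_ofPred_eq, hq.map_sup]; exact sup_le hx hy)
    (fun x hx y hy hxy => h x hx ((mono_q hxy).trans hy))
  have hW_top : W.mem ⊤ := hWb ⊤ (by simp [hp.map_top])
  -- `U` extends the image of `W` and contains `b`. This is consistent: `b ⊓ p w = ⊥` would mean `b
  -- ≤ p wᶜ`, so `W` would contain `wᶜ`.
  obtain ⟨U, hU, -⟩ := Point.exists_separating (F := {x | ∃ w, W.mem w ∧ x = b ⊓ p w}) (I := {⊥})
    ⟨_, ⊤, hW_top, rfl⟩ ⟨⊥, rfl⟩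
    (by
      rintro _ ⟨w, hw, rfl⟩ _ ⟨w', hw', rfl⟩
      exact ⟨w ⊓ w', (W.mem_inf _ _).2 ⟨hw, hw'⟩, by rw [hp.map_inf, inf_inf_inf_comm, inf_idem]⟩)
    (by simp)
    (by
      rintro _ ⟨w, hw, rfl⟩ _ rfl hle
      have : b ≤ p wᶜ := by
        rw [hp.map_compl, le_compl_iff_disjoint_right, disjoint_iff_inf_le]; exact hle
      exact (W.mem_compl w).1 (hWb _ this) hw)
  -- `V` extends the image of `W` and avoids `c`: `q w ≤ c` would put `w` into the ideal that `W`
  -- avoids.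
  obtain ⟨V, hV, hVc⟩ := Point.exists_separating (F := {x | ∃ w, W.mem w ∧ x = q w}) (I := {c})
    ⟨_, ⊤, hW_top, rfl⟩ ⟨c, rfl⟩
    (by
      rintro _ ⟨w, hw, rfl⟩ _ ⟨w', hw', rfl⟩
      exact ⟨w ⊓ w', (W.mem_inf _ _).2 ⟨hw, hw'⟩, by rw [hq.map_inf]⟩)
    (by simp)
    (by
      rintro _ ⟨w, hw, rfl⟩ _ rfl hle
      exact hWc w hle hw)
  have hUp : ∀ a, W.mem a → U.mem (p a) := fun a ha => U.mono inf_le_right (hU _ ⟨a, ha, rfl⟩)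
  have hVq : ∀ a, W.mem a → V.mem (q a) := fun a ha => hV _ ⟨a, ha, rfl⟩
  refine ⟨⟨(U, V), fun a => ?_⟩, U.mono inf_le_left (hU _ ⟨⊤, hW_top, rfl⟩), hVc c rfl⟩
  -- Points are maximal, so containing the images of all elements of `W` already forces both
  -- restrictions to equal `W`.
  by_cases ha : W.mem a
  · exact iff_of_true (hUp a ha) (hVq a ha)
  · have ha' := (W.mem_compl a).2 ha
    have h₁ := hUp _ ha'
    have h₂ := hVq _ ha'
    rw [hp.map_compl, U.mem_compl] at h₁
    rw [hq.map_compl, V.mem_compl] at h₂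
    exact iff_of_false h₁ h₂

/-- The canonical map of `B` into the complex algebra. -/
def inl (p : A → B) (q : A → C) (b : B) : Set (Pullback p q) := {z | z.1.1.mem b}

/-- The canonical map of `C` into the complex algebra. -/
def inr (p : A → B) (q : A → C) (c : C) : Set (Pullback p q) := {z | z.1.2.mem c}

theorem inl_inf {A : Type u} {p : A → B} {q : A → C} (x y : B) :
    inl p q (x ⊓ y) = inl p q x ⊓ inl p q y :=
  Set.ext fun z => z.1.1.mem_inf x y

theorem inl_compl {A : Type u} {p : A → B} {q : A → C} (x : B) :
    inl p q xᶜ = (inl p q x)ᶜ :=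
  Set.ext fun z => z.1.1.mem_compl x

theorem inr_inf {A : Type u} {p : A → B} {q : A → C} (x y : C) :
    inr p q (x ⊓ y) = inr p q x ⊓ inr p q y :=
  Set.ext fun z => z.1.2.mem_inf x y

theorem inr_compl {A : Type u} {p : A → B} {q : A → C} (x : C) :
    inr p q xᶜ = (inr p q x)ᶜ :=
  Set.ext fun z => z.1.2.mem_compl x

theorem exists_of_inl_le_inr (hp : IsMono n p) (hq : IsMono n q) {b : B} {c : C}
    (h : inl p q b ≤ inr p q c) : ∃ a, b ≤ p a ∧ q a ≤ c := by
  by_contra! hne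
  obtain ⟨z, hb, hc⟩ := exists_mem_not_mem hp hq hne
  exact hc (h hb)

theorem exists_of_inr_le_inl (hp : IsMono n p) (hq : IsMono n q) {b : B} {c : C}
    (h : inr p q c ≤ inl p q b) : ∃ a, c ≤ q a ∧ p a ≤ b := by
  have h' : inl p q bᶜ ≤ inr p q cᶜ := by
    rw [inl_compl, inr_compl]; exact compl_le_compl h
  obtain ⟨a, hb, hc⟩ := exists_of_inl_le_inr hp hq h'
  refine ⟨aᶜ, ?_, ?_⟩
  · rw [hq.map_compl]; exact le_compl_comm.1 hc
  · rw [hp.map_compl]; exact compl_le_of_compl_le hb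

theorem injective_of_forall_eq_bot {D E : Type*} [BooleanAlgebra D] [BooleanAlgebra E] {f : D → E}
    (hinf : ∀ x y, f (x ⊓ y) = f x ⊓ f y) (hcompl : ∀ x, f xᶜ = (f x)ᶜ)
    (h : ∀ x, f x ≤ ⊥ → x = ⊥) : Function.Injective f := by
  have key : ∀ x y, f x = f y → x ≤ y := by
    intro x y hxy
    rw [← compl_compl y, le_compl_iff_disjoint_right, disjoint_iff]
    exact h _ (by rw [hinf, hcompl, hxy, inf_compl_eq_bot])
  exact fun x y hxy => le_antisymm (key x y hxy) (key y x hxy.symm)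

theorem isMono_inl (hp : IsMono n p) (hq : IsMono n q) :
    letI := complexAlgebra hp hq
    IsMono n (inl p q) :=
  letI := complexAlgebra hp hq
  { injective := injective_of_forall_eq_bot inl_inf inl_compl fun x hx => by
      -- An interpolant between `x` and `⊥` is `⊥` because `q` is injective, and so `x = ⊥`.
      obtain ⟨a, hxa, ha⟩ := exists_of_inl_le_inr hp hq (c := ⊥) (hx.trans bot_le)
      have : a = ⊥ := hq.injective (by rw [hq.map_bot]; exact le_bot_iff.1 ha)
      rw [this, hp.map_bot] at hxa
      exact le_bot_iff.1 hxa
    map_inf := inl_inf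
    map_compl := inl_compl
    map_tr := fun _ _ _ _ => rfl
    map_rp := fun _ _ _ _ => rfl }

theorem isMono_inr (hp : IsMono n p) (hq : IsMono n q) :
    letI := complexAlgebra hp hq
    IsMono n (inr p q) :=
  letI := complexAlgebra hp hq
  { injective := injective_of_forall_eq_bot inr_inf inr_compl fun x hx => by
      obtain ⟨a, hxa, ha⟩ := exists_of_inr_le_inl hp hq (b := ⊥) (hx.trans bot_le)
      have : a = ⊥ := hp.injective (by rw [hp.map_bot]; exact le_bot_iff.1 ha)
      rw [this, hq.map_bot] at hxa
      exact le_bot_iff.1 hxa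
    map_inf := inr_inf
    map_compl := inr_compl
    map_tr := fun _ _ _ _ => rfl
    map_rp := fun _ _ _ _ => rfl }

end Pullback

theorem superAmalgamation (n : ℕ) : SuperAmalgamation.{u} n := by
  intro A B C _ _ _ _ _ _ p q hp hq
  exact ⟨Set (Pullback p q), inferInstance, Pullback.complexAlgebra hp hq,
    Pullback.inl p q, Pullback.inr p q, Pullback.isMono_inl hp hq, Pullback.isMono_inr hp hq,
    fun a => Set.ext fun z => z.2 a, fun _ _ => Pullback.exists_of_inl_le_inr hp hq,
    fun _ _ => Pullback.exists_of_inr_le_inl hp hq⟩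

end Amalgamation

end SA

theorem mainTheorem4 (n : ℕ) :
    SA.LocallyFinite.{u} n ∧
    (∀ (A : Type u) [BooleanAlgebra A] [SA n A] (m : ℕ) (X : Finset A), X.card = m →
      SA.Sg n (X : Set A) = Set.univ → Finite A ∧ Nat.card A ≤ 2 ^ 2 ^ (m * n ^ n)) ∧
    SA.SuperAmalgamation.{u} n := by
  refine ⟨fun A _ _ X hX => SA.finite_Sg hX, fun A _ _ m X hm hX => ?_, SA.superAmalgamation n⟩
  have h₁ := SA.finite_Sg (n := n) X.finite_toSet
  have h₂ := SA.card_Sg_le (n := n) X.finite_toSet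
  rw [hX] at h₁ h₂
  refine ⟨Set.finite_univ_iff.1 h₁, ?_⟩
  simpa [Nat.card_univ, hm] using h₂
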